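/- Rings are associative with $1\neq 0$; subrings contain $1$ and ring homomorphisms preserve $1$. A group (ring) is co-Hopfian if it is not isomorphic to a proper subgroup (proper subring) of itself. An element $g$ of a group $\Gamma$ is a test element if every endomorphism of $\Gamma$ fixing $g$ is an automorphism. A subgroup $R\le\Gamma$ is a retract if there is a homomorphism $\Gamma\to R$ restricting to the identity on $R$. A group is a Turner group if every element lying in no proper retract is a test element. For an ultrafilter $D$ on a set $I$, $M^I/D$ denotes the ultrapower of $M$. Elementary equivalence and elementary classes (classes of all models, among groups or among rings, of a set of first-order sentences) refer to the first-order languages of groups and of rings. Let $k=\overline{\mathbb F_2}$ be the algebraic closure of the field with two elements. Then: 1. $SL_2(k)$ is a Turner group and a co-Hopfian group, and $k$ is a co-Hopfian ring. 2. There are a set $I$ and an ultrafilter $D$ on $I$ such that $SL_2(k)^I/D\cong SL_2(k^I/D)$, the field $k^I/D$ is isomorphic to a proper subfield of itself, $SL_2(k)$ is elementarily equivalent to $SL_2(k)^I/D$ and $k$ is elementarily equivalent to $k^I/D$, while $SL_2(k)^I/D$ is neither a Turner group nor a co-Hopfian group and $k^I/D$ is not a co-Hopfian ring. 3. Consequently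 the class of Turner groups is not closed under ultrapowers, hence not closed under elementary equivalence. Likewise the class of co-Hopfian groups and the class of co-Hopfian rings are not closed under ultrapowers and not closed under elementary equivalence; in particular they are not elementary classes. -/

import Mathlib

open FirstOrder Filter

/-! ### Test elements, retracts, Turner groups -/

/-- `g` is a test element of `G`: every endomorphism of `G` that fixes `g` is an automorphism. -/
def IsTestElement {G : Type*} [Group G] (g : G) : Prop :=
  ∀ φ : G →* G, φ g = g → Function.Bijective φ

/-- `R` is a retract of `G`: some homomorphism `G → R` restricts to the identity on `R`. -/
def IsGroupRetract {G : Type*} [Group G] (R : Subgroup G) : Prop :=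
  ∃ ρ : G →* R, ∀ r : R, ρ (r : G) = r

/-- `G` is a Turner group: every element that lies in no proper retract is a test element. -/
def IsTurnerGroup (G : Type*) [Group G] : Prop :=
  ∀ g : G, (∀ R : Subgroup G, IsGroupRetract R → R ≠ ⊤ → g ∉ R) → IsTestElement g

/-! ### Co-Hopfian groups and rings -/

/-- `G` is not isomorphic to a proper subgroup of itself. -/
def IsCoHopfianGroup (G : Type*) [Group G] : Prop :=
  ¬ ∃ H : Subgroup G, H ≠ ⊤ ∧ Nonempty (G ≃* H)

/-- `R` is not isomorphic to a proper (unital) subring of itself. -/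
def IsCoHopfianRing (R : Type*) [Ring R] : Prop :=
  ¬ ∃ S : Subring R, S ≠ ⊤ ∧ Nonempty (R ≃+* S)

/-! ### The first-order language of groups -/

/-- The function symbols of the language of groups: multiplication, inverse, identity. -/
inductive GroupFunc : ℕ → Type
  | mul : GroupFunc 2
  | inv : GroupFunc 1
  | one : GroupFunc 0

/-- The first-order language of groups. -/
def groupLanguage : FirstOrder.Language.{0, 0} where
  Functions := GroupFunc
  Relations := fun _ => Empty

/-- A group as a structure for the language of groups. -/
instance groupLanguageStructure (G : Type*) [Group G] : groupLanguage.Structure G where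
  funMap := fun {n} f =>
    match n, f with
    | _, .mul => fun x => x 0 * x 1
    | _, .inv => fun x => (x 0)⁻¹
    | _, .one => fun _ => 1
  RelMap := fun r _ => r.elim

/-- `G` and `H` satisfy the same first-order sentences in the language of groups. -/
def GroupElemEquiv (G H : Type*) [Group G] [Group H] : Prop :=
  groupLanguage.ElementarilyEquivalent G H

/-- The ring `R` satisfies the first-order sentence `φ` in the language of rings. -/
def RingSatisfies (R : Type*) [Ring R] (φ : FirstOrder.Language.ring.Sentence) : Prop :=
  letI := FirstOrder.Ring.compatibleRingOfRing R
  R ⊨ φ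

/-- `R` and `S` satisfy the same first-order sentences in the language of rings. -/
def RingElemEquiv (R S : Type*) [Ring R] [Ring S] : Prop :=
  ∀ φ : FirstOrder.Language.ring.Sentence, RingSatisfies R φ ↔ RingSatisfies S φ

/-! ### Closure properties of classes of groups and of rings

The ultrapower of `M` over the index set `I` modulo the ultrafilter `D` is
`Germ (D : Filter I) M`, the quotient of `I → M` by `D`-almost everywhere equality, with the
operations induced from the coordinatewise ones. Rings are associative with `1 ≠ 0`. -/

/-- The class `P` of groups contains every ultrapower of each of its members. -/
def GroupClassClosedUnderUltrapowers (P : (G : Type) → [Group G] → Prop) : Prop :=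
  ∀ (G : Type) [Group G] (I : Type) (D : Ultrafilter I), P G → P (Germ (D : Filter I) G)

/-- The class `P` of groups is closed under elementary equivalence. -/
def GroupClassClosedUnderElemEquiv (P : (G : Type) → [Group G] → Prop) : Prop :=
  ∀ (G H : Type) [Group G] [Group H], GroupElemEquiv G H → P G → P H

/-- The class `P` of groups is the class of all groups that are models of some set of
first-order sentences. -/
def IsElementaryGroupClass (P : (G : Type) → [Group G] → Prop) : Prop :=
  ∃ T : Set groupLanguage.Sentence, ∀ (G : Type) [Group G], P G ↔ ∀ φ ∈ T, G ⊨ φ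

/-- The class `P` of rings contains every ultrapower of each of its members. -/
def RingClassClosedUnderUltrapowers (P : (R : Type) → [Ring R] → Prop) : Prop :=
  ∀ (R : Type) [Ring R] [Nontrivial R] (I : Type) (D : Ultrafilter I),
    P R → P (Germ (D : Filter I) R)

/-- The class `P` of rings is closed under elementary equivalence. -/
def RingClassClosedUnderElemEquiv (P : (R : Type) → [Ring R] → Prop) : Prop :=
  ∀ (R S : Type) [Ring R] [Ring S] [Nontrivial R] [Nontrivial S],
    RingElemEquiv R S → P R → P S

/-- The class `P` of rings is the class of all rings that are models of some set of
first-order sentences. -/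
def IsElementaryRingClass (P : (R : Type) → [Ring R] → Prop) : Prop :=
  ∃ T : Set FirstOrder.Language.ring.Sentence,
    ∀ (R : Type) [Ring R] [Nontrivial R], P R ↔ ∀ φ ∈ T, RingSatisfies R φ

/-! ### The field `k` and the group `SL₂` -/

/-- The algebraic closure of the field with two elements. -/
abbrev FTwoBar : Type := AlgebraicClosure (ZMod 2)

/-- The group `SL₂(R)`. -/
abbrev SLTwo (R : Type*) [CommRing R] : Type _ := Matrix.SpecialLinearGroup (Fin 2) R

/-! For an infinite field of characteristic two, `SL₂` is simple, so its retracts are trivial or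
everything, and an endomorphism fixing a nontrivial element is injective. Hence co-Hopfian implies
Turner (`IsCoHopfianGroup.isTurnerGroup`), while a nonsurjective endomorphism fixing a nontrivial
element refutes Turner.

Over `k` an injective endomorphism can be conjugated to send `upper 1` to some `upper b` and a
nontrivial torus element into the torus. It then maps torus to torus, and this map is onto because
every unit of `k` is a root of unity. The image thus contains a Borel subgroup and an element
outside it, so it is everything (`SLTwo.surjective_of_injective`).

A nonprincipal ultrapower `K` of `k` over `ℕ` is algebraically closed and uncountable. By Steinitz,
discarding one element of a transcendence basis gives a proper subfield isomorphic to `K`. The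
resulting nonsurjective `σ : K →+* K` acts on `SL₂(K)`, the ultrapower of `SL₂(k)`, and fixes `upper
1`. Elementary equivalence comes from Łoś for groups and completeness of ACF for fields. -/

/-! ### Elements of `SL₂` -/

namespace SLTwo

open Matrix

section Elements

variable {R : Type*} [CommRing R]

/-- The upper unipotent matrix with entry `x`. -/
def upper (x : R) : SLTwo R := ⟨!![1, x; 0, 1], by simp⟩

/-- The lower unipotent matrix with entry `x`. -/
def lower (x : R) : SLTwo R := ⟨!![1, 0; x, 1], by simp⟩

/-- The diagonal matrix with entries `t, t⁻¹`. -/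
def torus (t : Rˣ) : SLTwo R := ⟨!![(t : R), 0; 0, ((t⁻¹ : Rˣ) : R)], by simp⟩

/-- The Weyl element. -/
def weyl : SLTwo R := ⟨!![0, 1; -1, 0], by simp⟩

@[simp] lemma coe_upper (x : R) : (upper x : Matrix (Fin 2) (Fin 2) R) = !![1, x; 0, 1] := rfl

@[simp] lemma coe_lower (x : R) : (lower x : Matrix (Fin 2) (Fin 2) R) = !![1, 0; x, 1] := rfl

@[simp] lemma coe_torus (t : Rˣ) :
    (torus t : Matrix (Fin 2) (Fin 2) R) = !![(t : R), 0; 0, ((t⁻¹ : Rˣ) : R)] := rfl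

@[simp] lemma coe_weyl : ((weyl : SLTwo R) : Matrix (Fin 2) (Fin 2) R) = !![0, 1; -1, 0] := rfl

lemma ext_entries {g h : SLTwo R} (h₀₀ : g 0 0 = h 0 0) (h₀₁ : g 0 1 = h 0 1)
    (h₁₀ : g 1 0 = h 1 0) (h₁₁ : g 1 1 = h 1 1) : g = h := by
  ext i j
  fin_cases i <;> fin_cases j <;> assumption

lemma mul_entry (g h : SLTwo R) (i j : Fin 2) :
    (g * h) i j = g i 0 * h 0 j + g i 1 * h 1 j := by
  simp [Matrix.mul_apply, Fin.sum_univ_two]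

lemma inv_entry_zero_zero (g : SLTwo R) : g⁻¹ 0 0 = g 1 1 := by
  simp [adjugate_fin_two]

lemma inv_entry_zero_one (g : SLTwo R) : g⁻¹ 0 1 = -g 0 1 := by
  simp [adjugate_fin_two]

lemma inv_entry_one_zero (g : SLTwo R) : g⁻¹ 1 0 = -g 1 0 := by
  simp [adjugate_fin_two]

lemma inv_entry_one_one (g : SLTwo R) : g⁻¹ 1 1 = g 0 0 := by
  simp [adjugate_fin_two]

lemma det_entries (g : SLTwo R) : g 0 0 * g 1 1 - g 0 1 * g 1 0 = 1 := by
  rw [← Matrix.det_fin_two, g.det_coe]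

lemma upper_add (x y : R) : upper (x + y) = upper x * upper y := by
  apply ext_entries <;> simp [mul_entry, add_comm]

lemma upper_zero : upper (0 : R) = 1 := by
  apply ext_entries <;> simp

lemma upper_neg (x : R) : upper (-x) = (upper x)⁻¹ :=
  eq_inv_of_mul_eq_one_left (by rw [← upper_add, neg_add_cancel, upper_zero])

lemma lower_neg (x : R) : lower (-x) = (lower x)⁻¹ :=
  eq_inv_of_mul_eq_one_left (by apply ext_entries <;> simp [mul_entry])

lemma torus_conj_upper (t : Rˣ) (x : R) :
    torus t * upper x * (torus t)⁻¹ = upper (t * x * t) := by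
  apply ext_entries <;>
    simp [mul_entry, inv_entry_zero_zero, inv_entry_zero_one, inv_entry_one_zero,
      inv_entry_one_one]

lemma weyl_conj_upper (x : R) : weyl * upper x * weyl⁻¹ = lower (-x) := by
  apply ext_entries <;>
    simp [mul_entry, inv_entry_zero_zero, inv_entry_zero_one, inv_entry_one_zero,
      inv_entry_one_one]

lemma torus_mul (s t : Rˣ) : torus (s * t) = torus s * torus t := by
  apply ext_entries <;> simp [mul_entry, mul_comm]

lemma torus_injective : Function.Injective (torus : Rˣ → SLTwo R) := fun s t h =>
  Units.ext (by simpa using congrArg (fun g : SLTwo R => g 0 0) h)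

lemma upper_injective : Function.Injective (upper : R → SLTwo R) := fun s t h => by
  simpa using congrArg (fun g : SLTwo R => g 0 1) h

end Elements

/-! ### Bruhat decomposition and generation over a field. -/

section Field

variable {K : Type*} [Field K]

lemma eq_torus_mul_upper (g : SLTwo K) (h : g 1 0 = 0) :
    ∃ (t : Kˣ) (x : K), g = torus t * upper x := by
  have hd := det_entries g
  rw [h, mul_zero, sub_zero] at hd
  have h0 : g 0 0 ≠ 0 := left_ne_zero_of_mul_eq_one hd
  refine ⟨Units.mk0 _ h0, (g 0 0)⁻¹ * g 0 1, ?_⟩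
  apply ext_entries <;> simp [mul_entry, h, h0]
  exact eq_inv_of_mul_eq_one_right hd

lemma eq_upper_mul_lower_mul_upper (g : SLTwo K) (h : g 1 0 ≠ 0) :
    g = upper ((g 0 0 - 1) / g 1 0) * lower (g 1 0) * upper ((g 1 1 - 1) / g 1 0) := by
  have hd := det_entries g
  apply ext_entries <;> simp [mul_entry] <;> field_simp
  · ring
  · linear_combination -hd
  · ring

/-- A subgroup that contains the upper and the lower unipotent matrices is everything. -/
lemma eq_top_of_upper_of_lower (N : Subgroup (SLTwo K)) (hu : ∀ x, upper x ∈ N)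
    (hl : ∀ x, lower x ∈ N) : N = ⊤ := by
  have key : ∀ g : SLTwo K, g 1 0 ≠ 0 → g ∈ N := fun g hg => by
    rw [eq_upper_mul_lower_mul_upper g hg]
    exact mul_mem (mul_mem (hu _) (hl _)) (hu _)
  refine eq_top_iff.2 fun g _ => ?_
  by_cases hg : g 1 0 = 0
  -- The lower left entry of `lower 1 * g` is `g 0 0`, which is nonzero as `g` is triangular.
  · have h1 : lower 1 * g ∈ N := key _ (by
      have hd := det_entries g
      rw [hg, mul_zero, sub_zero] at hd
      simpa [mul_entry, hg] using left_ne_zero_of_mul_eq_one hd)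
    exact (N.mul_mem_cancel_left (hl 1)).1 h1
  · exact key g hg

/-- A subgroup that contains the upper triangular matrices and one more matrix is everything. -/
lemma eq_top_of_torus_of_upper (N : Subgroup (SLTwo K)) (ht : ∀ t, torus t ∈ N)
    (hu : ∀ x, upper x ∈ N) {g : SLTwo K} (hg : g 1 0 ≠ 0) (hgN : g ∈ N) : N = ⊤ := by
  have hl : lower (g 1 0) ∈ N := by
    rw [eq_upper_mul_lower_mul_upper g hg] at hgN
    exact (N.mul_mem_cancel_left (hu _)).1 ((N.mul_mem_cancel_right (hu _)).1 hgN)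
  have hw : (weyl : SLTwo K) ∈ N := by
    have e : weyl = upper (g 1 0)⁻¹ * (lower (g 1 0))⁻¹ * upper (g 1 0)⁻¹ *
        torus (Units.mk0 _ hg)⁻¹ := by
      rw [← lower_neg]
      apply ext_entries <;> simp [mul_entry, hg]
    rw [e]
    exact mul_mem (mul_mem (mul_mem (hu _) (inv_mem hl)) (hu _)) (ht _)
  refine eq_top_of_upper_of_lower N hu fun x => ?_
  have := mul_mem (mul_mem hw (hu (-x))) (inv_mem hw)
  rwa [weyl_conj_upper, neg_neg] at this

end Field

section AlgClosed

variable {K : Type*} [Field K] [IsAlgClosed K]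

/-- Every element of `SL₂` over an algebraically closed field is conjugate to an upper triangular
one. -/
lemma exists_conj_upper_triangular (g : SLTwo K) : ∃ h : SLTwo K, (h * g * h⁻¹) 1 0 = 0 := by
  by_cases hb : g 0 1 = 0
  · refine ⟨weyl, ?_⟩
    simp [mul_entry, inv_entry_zero_zero, inv_entry_one_zero, hb]
  -- A root `x` makes `(1, -x)` an eigenvector of `g`, and `lower x` carries it to the first basis
  -- vector.
  · obtain ⟨x, hx⟩ := IsAlgClosed.exists_root
      (Polynomial.C (g 0 1) * Polynomial.X ^ 2 + Polynomial.C (g 1 1 - g 0 0) * Polynomial.X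
        + Polynomial.C (-g 1 0)) (by rw [Polynomial.degree_quadratic hb]; decide)
    refine ⟨lower x, ?_⟩
    simp [mul_entry, inv_entry_zero_zero, inv_entry_one_zero] at hx ⊢
    linear_combination -hx

end AlgClosed

end SLTwo

namespace SLTwo

open Matrix

/-! ### Simplicity, centralizers and involutions in characteristic two. -/

section CharTwo

variable {K : Type*} [Field K] [CharP K 2]

lemma eq_one_of_mul_self_eq_one {a : K} (h : a * a = 1) : a = 1 := by
  rcases mul_self_eq_one_iff.1 h with h | h
  · exact h
  · rw [h, CharTwo.neg_eq]

/-- A central scalar `r` has `r² = 1`, so `r = 1` and `SL₂ = PSL₂`; the latter is simple since some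
unit has square different from `1`. -/
instance isSimpleGroup_of_infinite [Infinite K] : IsSimpleGroup (SLTwo K) := by
  classical
  obtain ⟨a, ha⟩ := Infinite.exists_notMem_finset ({0, 1} : Finset K)
  simp only [Finset.mem_insert, Finset.mem_singleton, not_or] at ha
  have hs := Matrix.ProjectiveSpecialLinearGroup.rank_two_simple' (F := K)
    ⟨a, ha.1, fun h => ha.2 (eq_one_of_mul_self_eq_one (by rwa [← sq]))⟩
  have hc : Subgroup.center (SLTwo K) = ⊥ := by
    refine (Subgroup.eq_bot_iff_forall _).2 fun g hg => ?_
    obtain ⟨r, hr, hrg⟩ := Matrix.SpecialLinearGroup.mem_center_iff.1 hg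
    rw [Fintype.card_fin, sq] at hr
    rw [eq_one_of_mul_self_eq_one hr, map_one] at hrg
    exact Subtype.ext hrg.symm
  exact (((QuotientGroup.quotientMulEquivOfEq hc).trans
    QuotientGroup.quotientBot).isSimpleGroup_congr).1 hs

/-- The centralizer is the unipotent group up to sign, and signs vanish in characteristic two. -/
lemma exists_eq_upper_of_commute {g : SLTwo K} {b : K} (hb : b ≠ 0) (h : g * upper b = upper b * g) :
    ∃ x, g = upper x := by
  have h0 := congrArg (fun A : SLTwo K => A 0 0) h
  have h1 := congrArg (fun A : SLTwo K => A 0 1) h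
  simp [mul_entry] at h0 h1
  have hc : g 1 0 = 0 := h0.resolve_left hb
  have hd : g 0 0 = g 1 1 := by
    refine mul_right_cancel₀ hb ?_
    linear_combination h1
  have hdet := det_entries g
  rw [hc, ← hd, mul_zero, sub_zero] at hdet
  have ha := eq_one_of_mul_self_eq_one hdet
  refine ⟨g 0 1, ?_⟩
  apply ext_entries <;> simp [hc, ← hd, ha]

omit [CharP K 2] in
-- The lower left entry of the conjugate is `-b * (g 1 0)²`.
lemma entry_eq_zero_of_conj_upper {g : SLTwo K} {b x : K} (hb : b ≠ 0)
    (h : g * upper b * g⁻¹ = upper x) : g 1 0 = 0 := by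
  have h0 := congrArg (fun A : SLTwo K => A 1 0) h
  simpa [mul_entry, inv_entry_zero_zero, inv_entry_one_zero, hb, mul_comm, mul_add] using h0

lemma unit_mul_self_ne_one {s : Kˣ} (hs : s ≠ 1) : (s : K) ≠ ((s⁻¹ : Kˣ) : K) := fun h =>
  hs (Units.ext (eq_one_of_mul_self_eq_one (by nth_rw 2 [h]; simp)))

/-- The eigenvalues `s`, `s⁻¹` are distinct, so `g` preserves both eigenlines. -/
lemma exists_eq_torus_of_commute {g : SLTwo K} {s : Kˣ} (hs : s ≠ 1)
    (h : g * torus s = torus s * g) : ∃ t, g = torus t := by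
  have hs' := unit_mul_self_ne_one hs
  have h0 := congrArg (fun A : SLTwo K => A 0 1) h
  have h1 := congrArg (fun A : SLTwo K => A 1 0) h
  simp only [mul_entry, coe_torus] at h0 h1
  simp at h0 h1
  have hb : g 0 1 = 0 := by
    refine (mul_eq_zero.1 (?_ : ((s : K) - ((s⁻¹ : Kˣ) : K)) * g 0 1 = 0)).resolve_left
      (sub_ne_zero.2 hs')
    rw [Units.val_inv_eq_inv_val]
    linear_combination -h0
  have hc : g 1 0 = 0 := by
    refine (mul_eq_zero.1 (?_ : ((s : K) - ((s⁻¹ : Kˣ) : K)) * g 1 0 = 0)).resolve_left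
      (sub_ne_zero.2 hs')
    rw [Units.val_inv_eq_inv_val]
    linear_combination h1
  obtain ⟨t, x, rfl⟩ := eq_torus_mul_upper g hc
  refine ⟨t, ?_⟩
  have hx : x = 0 := by simpa [mul_entry] using hb
  rw [hx, upper_zero, mul_one]

/-- A torus element times a unipotent is conjugate, by a unipotent, to the torus element. -/
lemma exists_upper_conj_eq_torus {t : Kˣ} (ht : t ≠ 1) (x : K) :
    ∃ y, upper y * (torus t * upper x) * (upper y)⁻¹ = torus t := by
  have ht' := sub_ne_zero.2 (unit_mul_self_ne_one ht)
  obtain ⟨y, hy⟩ : ∃ y, y * (t - ((t⁻¹ : Kˣ) : K)) = t * x := ⟨_, div_mul_cancel₀ _ ht'⟩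
  refine ⟨y, ?_⟩
  rw [← upper_neg]
  apply ext_entries <;> simp [mul_entry] at hy ⊢
  linear_combination -hy

/-- Over an algebraically closed field of characteristic two, every involution is conjugate to an
upper unipotent matrix. -/
lemma exists_conj_eq_upper_of_mul_self [IsAlgClosed K] {g : SLTwo K} (hg : g ≠ 1)
    (hgg : g * g = 1) : ∃ (h : SLTwo K) (b : K), b ≠ 0 ∧ h * g * h⁻¹ = upper b := by
  obtain ⟨h, hh⟩ := exists_conj_upper_triangular g
  obtain ⟨t, x, htx⟩ := eq_torus_mul_upper _ hh
  have h2 : torus t * upper x * (torus t * upper x) = 1 := by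
    calc _ = h * (g * g) * h⁻¹ := by rw [← htx]; group
      _ = 1 := by rw [hgg, mul_one, mul_inv_cancel]
  have ht : t = 1 := Units.ext (eq_one_of_mul_self_eq_one (by
    simpa [mul_entry] using congrArg (fun A : SLTwo K => A 0 0) h2))
  have e : h * g * h⁻¹ = upper x := by
    rw [htx, ht]
    apply ext_entries <;> simp [mul_entry]
  refine ⟨h, x, ?_, e⟩
  rintro rfl
  rw [upper_zero, conj_eq_one_iff] at e
  exact hg e

end CharTwo

/-- An injective endomorphism of the unit group of a domain is surjective if all units have finite
order. -/
lemma surjective_of_injective_of_isOfFinOrder {R : Type*} [CommRing R] [IsDomain R]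
    (hR : ∀ u : Rˣ, IsOfFinOrder u) (χ : Rˣ →* Rˣ) (hχ : Function.Injective χ) :
    Function.Surjective χ := fun s => by
  have : NeZero (orderOf s) := ⟨(hR s).orderOf_pos.ne'⟩
  have hm : ∀ t ∈ rootsOfUnity (orderOf s) R, χ t ∈ rootsOfUnity (orderOf s) R := fun t ht => by
    rw [mem_rootsOfUnity] at ht ⊢
    rw [← map_pow, ht, map_one]
  -- A domain has finitely many roots of unity of given order, so `χ` permutes them.
  let f : rootsOfUnity (orderOf s) R → rootsOfUnity (orderOf s) R := fun t => ⟨χ t, hm t t.2⟩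
  have hf : Function.Injective f := fun a b hab =>
    Subtype.ext (hχ (congrArg Subtype.val hab))
  obtain ⟨t, ht⟩ := Finite.surjective_of_injective hf
    ⟨s, (mem_rootsOfUnity _ _).2 (pow_orderOf_eq_one s)⟩
  exact ⟨t, congrArg Subtype.val ht⟩

/-! ### Injective endomorphisms of `SL₂` are surjective. -/

section Endomorphism

variable {K : Type*} [Field K] [CharP K 2] [IsAlgClosed K]

/-- The normalized case, to which `surjective_of_injective` reduces by conjugation. -/
lemma surjective_of_map_upper_of_map_torus (hK : ∀ u : Kˣ, IsOfFinOrder u) (φ : SLTwo K →* SLTwo K)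
    (hφ : Function.Injective φ) {b : K} (hb : b ≠ 0) (hφb : φ (upper 1) = upper b) {t s : Kˣ}
    (hs : s ≠ 1) (hts : φ (torus t) = torus s) : Function.Surjective φ := by
  have htor : ∀ r, ∃ r', φ (torus r) = torus r' := fun r =>
    exists_eq_torus_of_commute hs (by
      rw [← hts, ← map_mul, ← map_mul, ← torus_mul, ← torus_mul, mul_comm])
  choose f hf using htor
  let χ : Kˣ →* Kˣ := MonoidHom.mk' f fun r r' => torus_injective (by
    rw [← hf, torus_mul, map_mul, hf, hf, torus_mul])
  have hχ : Function.Injective χ := fun r r' h => torus_injective (hφ (by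
    rw [hf, hf]; exact congrArg torus h))
  have hsurj := surjective_of_injective_of_isOfFinOrder hK χ hχ
  have ht : ∀ r, ∃ r', φ (torus r') = torus r := fun r => by
    obtain ⟨r', rfl⟩ := hsurj r
    exact ⟨r', hf r'⟩
  have hu : ∀ x, ∃ x', φ (upper x') = upper x := fun x => by
    by_cases hx : x = 0
    · exact ⟨0, by rw [hx, upper_zero, map_one]⟩
    -- Conjugation by `torus y` scales the entry by `y²`, so it takes `upper b` to `upper x`.
    · obtain ⟨y, hy⟩ := IsAlgClosed.exists_pow_nat_eq (x / b) two_pos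
      have hy0 : y ≠ 0 := by
        rintro rfl
        rw [zero_pow two_ne_zero] at hy
        exact div_ne_zero hx hb hy.symm
      obtain ⟨r, hr⟩ := ht (Units.mk0 y hy0)
      refine ⟨r * 1 * r, ?_⟩
      rw [← torus_conj_upper, map_mul, map_mul, map_inv, hr, hφb, torus_conj_upper,
        Units.val_mk0, mul_right_comm, ← sq, hy, div_mul_cancel₀ _ hb]
  -- Upper triangular matrices are images of upper triangular ones, and `weyl` is not one.
  have hweyl : φ weyl 1 0 ≠ 0 := fun h => by
    obtain ⟨r, x, hrx⟩ := eq_torus_mul_upper _ h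
    obtain ⟨r', hr'⟩ := ht r
    obtain ⟨x', hx'⟩ := hu x
    rw [← hr', ← hx', ← map_mul] at hrx
    simpa [mul_entry] using congrArg (fun A : SLTwo K => A 1 0) (hφ hrx)
  rw [← MonoidHom.range_eq_top]
  exact eq_top_of_torus_of_upper _ (fun r => (ht r).imp' torus fun _ h => h)
    (fun x => (hu x).imp' upper fun _ h => h) hweyl ⟨weyl, rfl⟩

/-- Over an algebraically closed field of characteristic two whose nonzero elements are roots of
unity, every injective endomorphism of `SL₂` is surjective. -/
theorem surjective_of_injective (hK : ∀ u : Kˣ, IsOfFinOrder u) (φ : SLTwo K →* SLTwo K)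
    (hφ : Function.Injective φ) : Function.Surjective φ := by
  classical
  have hconj : ∀ (ψ : SLTwo K →* SLTwo K) (h : SLTwo K),
      Function.Surjective ((MulAut.conj h).toMonoidHom.comp ψ) → Function.Surjective ψ :=
    fun ψ h H => (Function.Surjective.of_comp_iff' (MulAut.conj h).bijective ψ).1 H
  have h1 : φ (upper 1) ≠ 1 := fun h => one_ne_zero (upper_injective (hφ (by
    rw [h, upper_zero, map_one])))
  have h2 : φ (upper 1) * φ (upper 1) = 1 := by
    rw [← map_mul, ← upper_add, CharTwo.add_self_eq_zero, upper_zero, map_one]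
  obtain ⟨h, b, hb, hhb⟩ := exists_conj_eq_upper_of_mul_self h1 h2
  apply hconj φ h
  set ψ := (MulAut.conj h).toMonoidHom.comp φ with hψ
  have hψi : Function.Injective ψ := (MulAut.conj h).injective.comp hφ
  have hψb : ψ (upper 1) = upper b := hhb
  have hψu : ∀ x, ∃ x', ψ (upper x) = upper x' := fun x =>
    exists_eq_upper_of_commute hb (by
      rw [← hψb, ← map_mul, ← map_mul, ← upper_add, ← upper_add, add_comm])
  obtain ⟨a, ha⟩ := Infinite.exists_notMem_finset ({0, 1} : Finset K)
  simp only [Finset.mem_insert, Finset.mem_singleton, not_or] at ha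
  -- `torus a` conjugates `upper 1` to a unipotent, which forces `ψ (torus a)` to be upper
  -- triangular.
  obtain ⟨x, hx⟩ := hψu ((Units.mk0 a ha.1) * 1 * (Units.mk0 a ha.1))
  rw [← torus_conj_upper, map_mul, map_mul, map_inv, hψb] at hx
  obtain ⟨s, y, hsy⟩ := eq_torus_mul_upper _ (entry_eq_zero_of_conj_upper hb hx)
  have hs : s ≠ 1 := by
    rintro rfl
    -- If `s = 1`, the image of `torus a` is unipotent, hence squares to `1`, giving `a² = 1`.
    have e : torus (Units.mk0 a ha.1 * Units.mk0 a ha.1) = torus 1 := hψi (by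
      have e1 : (torus 1 : SLTwo K) = 1 := by apply ext_entries <;> simp
      rw [torus_mul, map_mul, hsy, e1, one_mul, ← upper_add, CharTwo.add_self_eq_zero,
        upper_zero, map_one])
    exact ha.2 (eq_one_of_mul_self_eq_one
      (by simpa using congrArg Units.val (torus_injective e)))
  obtain ⟨z, hz⟩ := exists_upper_conj_eq_torus hs y
  -- This conjugation makes the image of `torus a` diagonal and leaves `upper b` unchanged.
  apply hconj ψ (upper z)
  refine surjective_of_map_upper_of_map_torus hK _ ((MulAut.conj (upper z)).injective.comp hψi) hb
    (t := Units.mk0 a ha.1) ?_ hs ?_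
  · change upper z * ψ (upper 1) * (upper z)⁻¹ = upper b
    rw [hψb, ← upper_neg, ← upper_add, ← upper_add]
    congr 1
    ring
  · change upper z * ψ _ * (upper z)⁻¹ = _
    rw [hsy, hz]

end Endomorphism

end SLTwo

/-! ### Ultrapowers -/

section Ultrapower

variable {I : Type*} (D : Ultrafilter I)

instance germ_charP {K : Type*} [Field K] (p : ℕ) [CharP K p] :
    CharP (Germ (D : Filter I) K) p where
  cast_eq_zero_iff n := by
    rw [← CharP.cast_eq_zero_iff K p n]
    exact Germ.const_inj (l := (D : Filter I)) (a := (n : K)) (b := 0)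

/-- A monic polynomial over the germs lifts to a family of monic polynomials of the same degree; a
root chosen at each index gives a root. -/
instance germ_isAlgClosed {K : Type*} [Field K] [IsAlgClosed K] :
    IsAlgClosed (Germ (D : Filter I) K) := by
  refine IsAlgClosed.of_exists_root _ fun p hp hirr => ?_
  have hsurj : Function.Surjective (Germ.coeRingHom (D : Filter I) : (I → K) →+* _) := fun x =>
    Germ.inductionOn x fun f => ⟨f, rfl⟩
  obtain ⟨q, hqp, hdeg, hq⟩ := Polynomial.lifts_and_natDegree_eq_and_monic
    ((Polynomial.lifts_iff_coeff_lifts (f := (Germ.coeRingHom (D : Filter I) : (I → K) →+* _)) p).2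
      fun n => Set.mem_range.2 (hsurj _)) hp
  have hroot : ∀ i, ∃ x, ((q.map (Pi.evalRingHom _ i)).eval x : K) = 0 := fun i =>
    IsAlgClosed.exists_root _ (ne_of_gt (Polynomial.natDegree_pos_iff_degree_pos.1 (by
      rw [hq.natDegree_map, hdeg]; exact hirr.natDegree_pos)))
  choose x hx using hroot
  refine ⟨Germ.coeRingHom (D : Filter I) x, ?_⟩
  have hqx : q.eval x = 0 := funext fun i => by
    have := hx i
    rw [Polynomial.eval_map] at this
    rw [Pi.zero_apply, ← this]
    exact Polynomial.hom_eval₂ q (RingHom.id _) (Pi.evalRingHom (fun _ => K) i) x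
  rw [← hqp, Polynomial.eval_map, Polynomial.eval₂_hom, hqx, map_zero]

/-- The ultrapower of an infinite set along a nonprincipal ultrafilter on `ℕ` is uncountable. -/
theorem aleph0_lt_mk_germ_hyperfilter (M : Type*) [Infinite M] :
    Cardinal.aleph0 < Cardinal.mk (Germ (hyperfilter ℕ : Filter ℕ) M) := by
  classical
  rw [← not_le, Cardinal.mk_le_aleph0_iff]
  intro hc
  have hne : Nonempty (Germ (hyperfilter ℕ : Filter ℕ) M) := inferInstance
  obtain ⟨e, he⟩ := exists_surjective_nat (Germ (hyperfilter ℕ : Filter ℕ) M)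
  choose f hf using fun n => (Quotient.exists_rep (e n) : ∃ f, _ = e n)
  -- Diagonal argument: `g n` avoids `f 0 n, …, f n n`, so `g` differs from `f m` at every `n ≥ m`.
  choose g hg using fun n => Infinite.exists_notMem_finset ((Finset.range (n + 1)).image fun m => f m n)
  obtain ⟨m, hm⟩ := he (g : Germ (hyperfilter ℕ : Filter ℕ) M)
  rw [← hf m] at hm
  have h1 : f m =ᶠ[(hyperfilter ℕ : Filter ℕ)] g := Germ.coe_eq.1 hm
  have h2 : ∀ᶠ n in (hyperfilter ℕ : Filter ℕ), m ≤ n :=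
    Nat.hyperfilter_le_atTop (eventually_ge_atTop m)
  obtain ⟨n, hn1, hn2⟩ := (h1.and h2).exists
  exact hg n (Finset.mem_image.2 ⟨m, Finset.mem_range.2 (by omega), hn1⟩)

/-- The matrix of germs of a germ of matrices of determinant one. -/
def germToSLTwo {R : Type*} [CommRing R] (g : Germ (D : Filter I) (SLTwo R)) :
    SLTwo (Germ (D : Filter I) R) :=
  ⟨Matrix.of fun i j => g.map fun A => A i j, by
    refine Germ.inductionOn g fun f => ?_
    rw [Matrix.det_fin_two]
    exact Germ.coe_eq.2 (Eventually.of_forall fun n => SLTwo.det_entries (f n))⟩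

/-- The ultrapower of `SL₂(R)` is `SL₂` of the ultrapower of `R`. -/
noncomputable def germSLTwoEquiv (R : Type*) [CommRing R] :
    Germ (D : Filter I) (SLTwo R) ≃* SLTwo (Germ (D : Filter I) R) :=
  MulEquiv.ofBijective
    (MonoidHom.mk' (germToSLTwo D) fun g h => by
      refine Germ.inductionOn₂ g h fun f f' => ?_
      apply SLTwo.ext_entries <;> rw [SLTwo.mul_entry] <;>
        exact Germ.coe_eq.2 (Eventually.of_forall fun n => SLTwo.mul_entry (f n) (f' n) _ _))
    (by
      classical
      constructor
      · intro g h
        refine Germ.inductionOn₂ g h fun f f' hff => Germ.coe_eq.2 ?_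
        have key : ∀ i j, ∀ᶠ n in (D : Filter I), f n i j = f' n i j := fun i j =>
          Germ.coe_eq.1 (congrArg (fun A : SLTwo (Germ (D : Filter I) R) => A i j) hff)
        filter_upwards [key 0 0, key 0 1, key 1 0, key 1 1] with n using SLTwo.ext_entries
      · intro A
        choose a ha using fun i j => (Quotient.exists_rep (A i j) : ∃ f : I → R, _ = A i j)
        have hdet : ∀ᶠ n in (D : Filter I),
            (Matrix.of fun i j => a i j n : Matrix (Fin 2) (Fin 2) R).det = 1 := by
          have := SLTwo.det_entries A
          rw [← ha, ← ha, ← ha, ← ha] at this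
          filter_upwards [Germ.coe_eq.1 this] with n hn
          rw [Matrix.det_fin_two]
          exact hn
        -- The default `1` is used only on a `D`-null set of indices.
        let f : I → SLTwo R := fun n =>
          if h : (Matrix.of fun i j => a i j n : Matrix (Fin 2) (Fin 2) R).det = 1 then ⟨_, h⟩
          else 1
        have hf : ∀ i j, ∀ᶠ n in (D : Filter I), f n i j = a i j n := fun i j => by
          filter_upwards [hdet] with n hn
          have : f n = ⟨_, hn⟩ := dif_pos hn
          rw [this]
          rfl
        refine ⟨(f : Germ (D : Filter I) (SLTwo R)), SLTwo.ext_entries ?_ ?_ ?_ ?_⟩ <;>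
          rw [← ha] <;> exact Germ.coe_eq.2 (hf _ _))

/-- Łoś's theorem for groups: a group is elementarily equivalent to its ultrapowers. -/
theorem groupElemEquiv_germ (G : Type*) [Group G] :
    GroupElemEquiv G (Germ (D : Filter I) G) := by
  -- Both are the same quotient of `I → G`; the two structures are compared on representatives.
  let e : groupLanguage.Equiv ((D : Filter I).Product fun _ => G) (Germ (D : Filter I) G) :=
    { Equiv.refl (Germ (D : Filter I) G) with
      map_fun' := fun {n} f x => by
        choose y hy using fun i => (Quotient.exists_rep (x i) : ∃ y : I → G, _ = x i)
        obtain rfl : _ = x := funext hy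
        refine (congrArg _ (FirstOrder.Language.Ultraproduct.funMap_cast (u := D) f y)).trans ?_
        cases f <;> rfl
      map_rel' := fun {n} r => r.elim }
  refine FirstOrder.Language.ElementarilyEquivalent.trans ?_
    (FirstOrder.Language.StrongHomClass.elementarilyEquivalent e)
  refine FirstOrder.Language.elementarilyEquivalent_iff.2 fun φ => ?_
  rw [FirstOrder.Language.Ultraproduct.sentence_realize, eventually_const]

/-- Algebraically closed fields of the same characteristic are elementarily equivalent. -/
theorem ringElemEquiv_of_isAlgClosed (K L : Type*) [Field K] [Field L] [IsAlgClosed K]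
    [IsAlgClosed L] {p : ℕ} (hp : p.Prime ∨ p = 0) [CharP K p] [CharP L p] :
    RingElemEquiv K L := fun φ => by
  let := FirstOrder.Ring.compatibleRingOfRing K
  let := FirstOrder.Ring.compatibleRingOfRing L
  have h := FirstOrder.Field.ACF_isComplete hp
  exact (h.realize_sentence_iff φ K).trans (h.realize_sentence_iff φ L).symm

end Ultrapower

/-! ### Uncountable algebraically closed fields -/

section Steinitz

open IntermediateField

/-- An uncountable algebraically closed field of prime characteristic is isomorphic to a proper
subfield. -/
theorem exists_proper_subfield_ringEquiv (K : Type*) [Field K] [IsAlgClosed K] (p : ℕ)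
    [Fact p.Prime] [CharP K p] (hK : Cardinal.aleph0 < Cardinal.mk K) :
    ∃ F : Subfield K, F ≠ ⊤ ∧ Nonempty (K ≃+* F) := by
  let : Algebra (ZMod p) K := ZMod.algebra K p
  obtain ⟨s, hs⟩ := exists_isTranscendenceBasis (ZMod p) K
  have hcard : Cardinal.mk K = Cardinal.mk s :=
    Cardinal.lift_injective
      (IsAlgClosed.cardinal_eq_cardinal_transcendence_basis_of_aleph0_lt _ hs
        (Cardinal.lt_aleph0_of_finite _).le hK)
  have hinf : Cardinal.aleph0 ≤ Cardinal.mk s := hcard ▸ hK.le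
  have hsne : s.Nonempty := by
    rw [← Set.nonempty_coe_sort, ← Cardinal.mk_ne_zero_iff]
    exact (Cardinal.aleph0_pos.trans_le hinf).ne'
  obtain ⟨x, hx⟩ := hsne
  -- Dropping `x` from the infinite basis keeps its cardinality, so `F` has the cardinality of `K`.
  let E := adjoin (ZMod p) (s \ {x})
  let F := algebraicClosure E K
  have hF : Cardinal.mk K = Cardinal.mk F := by
    refine le_antisymm ?_ (Cardinal.mk_le_of_injective Subtype.val_injective)
    have hle : Cardinal.mk s ≤ Cardinal.mk (s \ {x} : Set K) := by
      have h := Cardinal.mk_sdiff_add_mk (Set.singleton_subset_iff.2 hx)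
      rw [Cardinal.mk_singleton] at h
      rw [← h]
      refine (Cardinal.add_one_eq ?_).le
      by_contra hlt
      exact (h ▸ hinf).not_gt (Cardinal.add_lt_aleph0 (not_le.1 hlt) Cardinal.one_lt_aleph0)
    rw [hcard]
    exact hle.trans (Cardinal.mk_le_mk_of_subset fun y hy =>
      mem_algebraicClosure_iff.2 (isAlgebraic_algebraMap
        (⟨y, subset_adjoin _ _ hy⟩ : E)))
  have : CharP F p := inferInstance
  have : IsAlgClosed F := IsAlgClosure.isAlgClosed E
  obtain ⟨e⟩ := IsAlgClosed.ringEquiv_of_equiv_of_char_eq (K := K) (L := F) p hK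
    (Cardinal.eq.1 hF)
  refine ⟨F.toSubfield, fun htop => ?_, ⟨e⟩⟩
  have hxF : x ∈ F := by
    have : x ∈ F.toSubfield := htop ▸ trivial
    exact this
  have h1 : IsAlgebraic E x := mem_algebraicClosure_iff.1 hxF
  -- Algebraic independence keeps `x` out of `F`.
  have h2 := hs.1.transcendental_adjoin (s := {⟨x, hx⟩}ᶜ) (i := ⟨x, hx⟩) (by simp)
  have h3 : ((↑) : s → K) '' {⟨x, hx⟩}ᶜ = s \ {x} := by
    ext y
    simp
  rw [h3] at h2
  exact h2 (isAlgebraic_adjoin_iff.1 h1)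

end Steinitz

/-! ### Turner groups and co-Hopfian groups and rings -/

section General

lemma IsCoHopfianGroup.surjective {G : Type*} [Group G] (h : IsCoHopfianGroup G) (φ : G →* G)
    (hφ : Function.Injective φ) : Function.Surjective φ := by
  rw [← MonoidHom.range_eq_top]
  by_contra hne
  exact h ⟨φ.range, hne, ⟨MonoidHom.ofInjective hφ⟩⟩

lemma isCoHopfianGroup_of_surjective {G : Type*} [Group G]
    (h : ∀ φ : G →* G, Function.Injective φ → Function.Surjective φ) : IsCoHopfianGroup G := by
  rintro ⟨H, hH, ⟨e⟩⟩
  refine hH (eq_top_iff.2 fun g _ => ?_)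
  obtain ⟨x, hx⟩ := h (H.subtype.comp e.toMonoidHom)
    (Subtype.val_injective.comp e.injective) g
  exact hx ▸ (e x).2

lemma isCoHopfianRing_of_surjective {R : Type*} [Ring R]
    (h : ∀ φ : R →+* R, Function.Injective φ → Function.Surjective φ) : IsCoHopfianRing R := by
  rintro ⟨S, hS, ⟨e⟩⟩
  refine hS (eq_top_iff.2 fun r _ => ?_)
  obtain ⟨x, hx⟩ := h (S.subtype.comp e.toRingHom)
    (Subtype.val_injective.comp e.injective) r
  exact hx ▸ (e x).2

lemma IsTestElement.of_mulEquiv {G H : Type*} [Group G] [Group H] (e : G ≃* H) {g : G}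
    (hg : IsTestElement (e g)) : IsTestElement g := fun φ hφ => by
  have := hg ((e.toMonoidHom.comp φ).comp e.symm.toMonoidHom) (by simp [hφ])
  have h2 : (φ : G → G) =
      e.symm ∘ ((e.toMonoidHom.comp φ).comp e.symm.toMonoidHom) ∘ e := by
    ext x
    simp
  rw [h2]
  exact e.symm.bijective.comp (this.comp e.bijective)

lemma IsGroupRetract.map_mulEquiv {G H : Type*} [Group G] [Group H] (e : G ≃* H) {R : Subgroup G}
    (hR : IsGroupRetract R) : IsGroupRetract (R.map e.toMonoidHom) := by
  obtain ⟨ρ, hρ⟩ := hR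
  refine ⟨((e.toMonoidHom.subgroupMap R).comp ρ).comp e.symm.toMonoidHom, ?_⟩
  rintro ⟨_, r, hr, rfl⟩
  have := hρ ⟨r, hr⟩
  apply Subtype.ext
  change e (ρ (e.symm (e r)) : G) = e r
  rw [e.symm_apply_apply, this]

lemma IsTurnerGroup.of_mulEquiv {G H : Type*} [Group G] [Group H] (e : G ≃* H)
    (hH : IsTurnerGroup H) : IsTurnerGroup G := fun g hg => by
  refine IsTestElement.of_mulEquiv e (hH (e g) fun R hR hne hmem => ?_)
  refine hg _ (hR.map_mulEquiv e.symm) (fun htop => hne ?_) ⟨e g, hmem, by simp⟩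
  refine eq_top_iff.2 fun h _ => ?_
  obtain ⟨r, hr, hre⟩ : e.symm h ∈ R.map e.symm.toMonoidHom := htop ▸ trivial
  exact e.symm.injective hre ▸ hr

lemma IsCoHopfianGroup.of_mulEquiv {G H : Type*} [Group G] [Group H] (e : G ≃* H)
    (hH : IsCoHopfianGroup H) : IsCoHopfianGroup G :=
  isCoHopfianGroup_of_surjective fun φ hφ => by
    have := hH.surjective ((e.toMonoidHom.comp φ).comp e.symm.toMonoidHom)
      (e.injective.comp (hφ.comp e.symm.injective))
    have h2 : (φ : G → G) =
        e.symm ∘ ((e.toMonoidHom.comp φ).comp e.symm.toMonoidHom) ∘ e := by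
      ext x
      simp
    rw [h2]
    exact e.symm.surjective.comp (this.comp e.surjective)

/-- The trivial subgroup is a retract. -/
lemma isGroupRetract_bot (G : Type*) [Group G] : IsGroupRetract (⊥ : Subgroup G) :=
  ⟨1, fun _ => Subsingleton.elim _ _⟩

/-- A simple group has no proper retract except the trivial one. -/
lemma IsGroupRetract.eq_bot_or_eq_top {G : Type*} [Group G] [IsSimpleGroup G] {R : Subgroup G}
    (hR : IsGroupRetract R) : R = ⊥ ∨ R = ⊤ := by
  obtain ⟨ρ, hρ⟩ := hR
  rcases (inferInstance : ρ.ker.Normal).eq_bot_or_eq_top with h | h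
  · right
    refine eq_top_iff.2 fun g _ => ?_
    have : ρ (ρ g : G) = ρ g := hρ (ρ g)
    exact (MonoidHom.ker_eq_bot_iff ρ).1 h this ▸ (ρ g).2
  · left
    refine (Subgroup.eq_bot_iff_forall _).2 fun r hr => ?_
    have h1 : ρ r = 1 := by
      rw [← MonoidHom.mem_ker, h]
      trivial
    rw [hρ ⟨r, hr⟩] at h1
    exact congrArg Subtype.val h1

/-- A simple group is Turner if its injective endomorphisms are surjective. -/
lemma IsCoHopfianGroup.isTurnerGroup {G : Type*} [Group G] [IsSimpleGroup G]
    (h : IsCoHopfianGroup G) : IsTurnerGroup G := fun g hg φ hφ => by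
  have hg1 : g ≠ 1 := by
    rintro rfl
    exact hg ⊥ (isGroupRetract_bot G) bot_ne_top (one_mem _)
  have hinj : Function.Injective φ := by
    rcases (inferInstance : φ.ker.Normal).eq_bot_or_eq_top with hk | hk
    · exact (MonoidHom.ker_eq_bot_iff φ).1 hk
    · have : g ∈ φ.ker := hk ▸ trivial
      rw [MonoidHom.mem_ker, hφ] at this
      exact absurd this hg1
  exact ⟨hinj, h.surjective φ hinj⟩

/-- A simple group with a nonsurjective endomorphism that fixes a nontrivial element is not
Turner. -/
lemma not_isTurnerGroup_of_map_eq {G : Type*} [Group G] [IsSimpleGroup G] {φ : G →* G} {g : G}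
    (hg : g ≠ 1) (hφg : φ g = g) (hφ : ¬ Function.Surjective φ) : ¬ IsTurnerGroup G := fun h => by
  refine hφ (h g (fun R hR hne hgR => ?_) φ hφg).2
  rw [hR.eq_bot_or_eq_top.resolve_right hne, Subgroup.mem_bot] at hgR
  exact hg hgR

end General

/-! ### `SL₂` over a field isomorphic to a proper subfield -/

section ProperSubfield

open Matrix

variable {K : Type*} [Field K]

lemma not_surjective_map_of_not_surjective {σ : K →+* K} (hσ : ¬ Function.Surjective σ) :
    ¬ Function.Surjective (Matrix.SpecialLinearGroup.map (n := Fin 2) σ) := fun h => hσ fun x => by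
  obtain ⟨g, hg⟩ := h (SLTwo.upper x)
  exact ⟨g 0 1, by simpa using congrArg (fun A : SLTwo K => A 0 1) hg⟩

/-- The entries of `upper 1` are `0` and `1`, so every `σ` fixes it. -/
lemma not_isTurnerGroup_sLTwo [CharP K 2] [Infinite K] {σ : K →+* K}
    (hσ : ¬ Function.Surjective σ) : ¬ IsTurnerGroup (SLTwo K) := by
  refine not_isTurnerGroup_of_map_eq (φ := Matrix.SpecialLinearGroup.map σ) (g := SLTwo.upper 1)
    (fun h => one_ne_zero (SLTwo.upper_injective (h.trans SLTwo.upper_zero.symm))) ?_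
    (not_surjective_map_of_not_surjective hσ)
  apply SLTwo.ext_entries <;> simp

lemma not_isCoHopfianGroup_sLTwo {σ : K →+* K} (hσ : ¬ Function.Surjective σ) :
    ¬ IsCoHopfianGroup (SLTwo K) := fun h => by
  refine not_surjective_map_of_not_surjective hσ (h.surjective _ fun A B hAB => ?_)
  ext i j
  exact σ.injective (congrArg (fun M : SLTwo K => M i j) hAB)

end ProperSubfield

/-! ### The algebraic closure of the field with two elements -/

/-- Each `u` lies in the finite field it generates. -/
lemma fTwoBar_isOfFinOrder (u : FTwoBarˣ) : IsOfFinOrder u := by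
  have hint : IsIntegral (ZMod 2) (u : FTwoBar) := Algebra.IsIntegral.isIntegral _
  have := IntermediateField.adjoin.finiteDimensional hint
  have : Finite (IntermediateField.adjoin (ZMod 2) {(u : FTwoBar)}) :=
    Module.finite_of_finite (ZMod 2)
  let v : (IntermediateField.adjoin (ZMod 2) {(u : FTwoBar)})ˣ :=
    Units.mk0 ⟨u, IntermediateField.mem_adjoin_simple_self _ _⟩
      fun h => u.ne_zero (congrArg Subtype.val h)
  have hv : Units.map (algebraMap _ FTwoBar).toMonoidHom v = u := Units.ext rfl
  rw [← hv]
  exact MonoidHom.isOfFinOrder _ (isOfFinOrder_of_finite v)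

instance : CharP FTwoBar 2 :=
  charP_of_injective_algebraMap (algebraMap (ZMod 2) FTwoBar).injective 2

theorem isCoHopfianGroup_sLTwo_fTwoBar : IsCoHopfianGroup (SLTwo FTwoBar) :=
  isCoHopfianGroup_of_surjective (SLTwo.surjective_of_injective fTwoBar_isOfFinOrder)

/-- Ring endomorphisms are linear over the prime field, and algebra endomorphisms of an algebraic
extension are bijective. -/
theorem isCoHopfianRing_fTwoBar : IsCoHopfianRing FTwoBar :=
  isCoHopfianRing_of_surjective fun φ _ => by
    let ψ : FTwoBar →ₐ[ZMod 2] FTwoBar :=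
      { φ with
        commutes' := fun r =>
          RingHom.congr_fun (Subsingleton.elim (φ.comp (algebraMap _ _)) _) r }
    exact (Algebra.IsAlgebraic.algHom_bijective ψ).2

theorem isTurnerGroup_sLTwo_fTwoBar : IsTurnerGroup (SLTwo FTwoBar) :=
  isCoHopfianGroup_sLTwo_fTwoBar.isTurnerGroup

/-! ### Nonclosure -/

lemma not_isElementaryGroupClass {P : (G : Type) → [Group G] → Prop}
    (h : ¬ GroupClassClosedUnderElemEquiv P) : ¬ IsElementaryGroupClass P := by
  rintro ⟨T, hT⟩
  refine h fun G H _ _ hGH hG => (hT H).2 fun φ hφ => ?_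
  exact (FirstOrder.Language.elementarilyEquivalent_iff.1 hGH φ).1 ((hT G).1 hG φ hφ)

lemma not_isElementaryRingClass {P : (R : Type) → [Ring R] → Prop}
    (h : ¬ RingClassClosedUnderElemEquiv P) : ¬ IsElementaryRingClass P := by
  rintro ⟨T, hT⟩
  exact h fun R S _ _ _ _ hRS hR => (hT S).2 fun φ hφ => (hRS φ).1 ((hT R).1 hR φ hφ)

theorem fTwoBar_ultrapower :
    ∃ (I : Type) (D : Ultrafilter I),
      Nonempty (Germ (D : Filter I) (SLTwo FTwoBar) ≃* SLTwo (Germ (D : Filter I) FTwoBar)) ∧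
      (∃ F : Subfield (Germ (D : Filter I) FTwoBar),
        F ≠ ⊤ ∧ Nonempty (Germ (D : Filter I) FTwoBar ≃+* F)) ∧
      GroupElemEquiv (SLTwo FTwoBar) (Germ (D : Filter I) (SLTwo FTwoBar)) ∧
      RingElemEquiv FTwoBar (Germ (D : Filter I) FTwoBar) ∧
      ¬ IsTurnerGroup (Germ (D : Filter I) (SLTwo FTwoBar)) ∧
      ¬ IsCoHopfianGroup (Germ (D : Filter I) (SLTwo FTwoBar)) ∧
      ¬ IsCoHopfianRing (Germ (D : Filter I) FTwoBar) := by
  obtain ⟨F, hF, ⟨e⟩⟩ := exists_proper_subfield_ringEquiv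
    (Germ (hyperfilter ℕ : Filter ℕ) FTwoBar) 2 (aleph0_lt_mk_germ_hyperfilter _)
  have hσ : ¬ Function.Surjective (F.subtype.comp e.toRingHom) := fun h => by
    refine hF (eq_top_iff.2 fun x _ => ?_)
    obtain ⟨y, rfl⟩ := h x
    exact (e y).2
  let E := germSLTwoEquiv (hyperfilter ℕ) FTwoBar
  refine ⟨ℕ, hyperfilter ℕ, ⟨E⟩, ⟨F, hF, ⟨e⟩⟩, groupElemEquiv_germ _ _,
    ringElemEquiv_of_isAlgClosed _ _ (Or.inl Nat.prime_two), fun h => ?_, fun h => ?_, fun h => ?_⟩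
  · exact not_isTurnerGroup_sLTwo hσ (h.of_mulEquiv E.symm)
  · exact not_isCoHopfianGroup_sLTwo hσ (h.of_mulEquiv E.symm)
  · refine h ⟨F.toSubring, fun htop => hF ?_, ⟨e⟩⟩
    exact eq_top_iff.2 fun x _ => show x ∈ F.toSubring from htop ▸ trivial

theorem mainTheorem3 :
    -- `SL₂(k)` is a Turner group, and `SL₂(k)` and `k` are co-Hopfian
    IsTurnerGroup (SLTwo FTwoBar) ∧
    IsCoHopfianGroup (SLTwo FTwoBar) ∧
    IsCoHopfianRing FTwoBar ∧
    -- some ultrapowers over one and the same ultrafilter are not, while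
    -- `SL₂(k)^I/D ≅ SL₂(k^I/D)` and `k^I/D` is isomorphic to a proper subfield of itself
    (∃ (I : Type) (D : Ultrafilter I),
      Nonempty (Germ (D : Filter I) (SLTwo FTwoBar) ≃* SLTwo (Germ (D : Filter I) FTwoBar)) ∧
      (∃ F : Subfield (Germ (D : Filter I) FTwoBar),
        F ≠ ⊤ ∧ Nonempty (Germ (D : Filter I) FTwoBar ≃+* F)) ∧
      GroupElemEquiv (SLTwo FTwoBar) (Germ (D : Filter I) (SLTwo FTwoBar)) ∧
      RingElemEquiv FTwoBar (Germ (D : Filter I) FTwoBar) ∧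
      ¬ IsTurnerGroup (Germ (D : Filter I) (SLTwo FTwoBar)) ∧
      ¬ IsCoHopfianGroup (Germ (D : Filter I) (SLTwo FTwoBar)) ∧
      ¬ IsCoHopfianRing (Germ (D : Filter I) FTwoBar)) ∧
    -- the class of Turner groups
    ¬ GroupClassClosedUnderUltrapowers (fun G _ => IsTurnerGroup G) ∧
    ¬ GroupClassClosedUnderElemEquiv (fun G _ => IsTurnerGroup G) ∧
    -- the class of co-Hopfian groups
    ¬ GroupClassClosedUnderUltrapowers (fun G _ => IsCoHopfianGroup G) ∧
    ¬ GroupClassClosedUnderElemEquiv (fun G _ => IsCoHopfianGroup G) ∧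
    ¬ IsElementaryGroupClass (fun G _ => IsCoHopfianGroup G) ∧
    -- the class of co-Hopfian rings
    ¬ RingClassClosedUnderUltrapowers (fun R _ => IsCoHopfianRing R) ∧
    ¬ RingClassClosedUnderElemEquiv (fun R _ => IsCoHopfianRing R) ∧
    ¬ IsElementaryRingClass (fun R _ => IsCoHopfianRing R) := by
  obtain ⟨I, D, hiso, hsub, hG, hR, hT, hH, hk⟩ := fTwoBar_ultrapower
  have hHe : ¬ GroupClassClosedUnderElemEquiv (fun G _ => IsCoHopfianGroup G) :=
    fun h => hH (h _ _ hG isCoHopfianGroup_sLTwo_fTwoBar)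
  have hke : ¬ RingClassClosedUnderElemEquiv (fun R _ => IsCoHopfianRing R) :=
    fun h => hk (h _ _ hR isCoHopfianRing_fTwoBar)
  exact ⟨isTurnerGroup_sLTwo_fTwoBar, isCoHopfianGroup_sLTwo_fTwoBar, isCoHopfianRing_fTwoBar,
    ⟨I, D, hiso, hsub, hG, hR, hT, hH, hk⟩,
    fun h => hT (h _ I D isTurnerGroup_sLTwo_fTwoBar),
    fun h => hT (h _ _ hG isTurnerGroup_sLTwo_fTwoBar),
    fun h => hH (h _ I D isCoHopfianGroup_sLTwo_fTwoBar), hHe, not_isElementaryGroupClass hHe,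
    fun h => hk (h _ I D isCoHopfianRing_fTwoBar), hke, not_isElementaryRingClass hke⟩
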